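/- Let $X$ be a complex Banach space with dual $X^*$, and let $B(X)$ be the space of bounded operators on $X$. Let $(\gamma_j)_{j\ge1}$ be independent standard complex Gaussian variables. A set $\mathcal E\subset B(X)$ is called $\gamma$-bounded if there is a constant $C\ge 0$ such that $$\Bigl(\mathbb E\Bigl\|\sum_{j=1}^n\gamma_j V_j(x_j)\Bigr\|^2\Bigr)^{1/2}\le C\Bigl(\mathbb E\Bigl\|\sum_{j=1}^n\gamma_j x_j\Bigr\|^2\Bigr)^{1/2}$$ for all finite families $(V_1,\dots,V_n)$ in $\mathcal E$ and $(x_1,\dots,x_n)$ in $X$; the least such $C$ is denoted $\gamma(\mathcal E)$. A function $A\colon\Omega\to B(X)$ is called $\gamma$-bounded if its range is, and then $\gamma(A)$ denotes the constant of its range. For a $\sigma$-finite measure space $(\Omega,\mu)$, let $\mathcal V_2(\Omega^2)$ be the set of all $\phi\in L^\infty(\Omega^2)$ for which there exist a complex Hilbert space $K$ and $a_1,a_2\in L^\infty(\Omega;K)$ such that $$\phi(s,t)=(a_2(t)\,|\,a_1(s))_K\quad\text{for a.e. }(s,t)\in\Omega^2,$$ and let $\nu_2(\phi)$ be the infimum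 of $\|a_1\|_\infty\|a_2\|_\infty$ over all such factorizations. **Theorem.** Let $(\Omega,\mu)$ be a $\sigma$-finite measure space and let $A,B\colon\Omega\to B(X)$ be $\gamma$-bounded and strongly measurable (that is, $t\mapsto A(t)x$ and $t\mapsto B(t)x$ are measurable as Bochner-space functions, i.e. almost everywhere limits of simple functions, for every $x\in X$). Then for all $x\in X$ and $x^*\in X^*$, the function $$\Theta_{x,x^*}(s,t)=\langle B(t)A(s)x,x^*\rangle,\qquad (s,t)\in\Omega^2,$$ belongs to $\mathcal V_2(\Omega^2)$, and $$\nu_2(\Theta_{x,x^*})\le\gamma(A)\,\gamma(B)\,\|x\|\,\|x^*\|.$$ -/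

import Mathlib

open MeasureTheory ProbabilityTheory
open scoped ENNReal NNReal

/-- The standard complex Gaussian law on `ℂ`: real and imaginary parts are independent, centred,
real Gaussian of variance `1/2` each, so that `E|γ|² = 1`. -/
noncomputable def stdComplexGaussian : Measure ℂ :=
  ((gaussianReal 0 (1 / 2)).prod (gaussianReal 0 (1 / 2))).map Complex.measurableEquivRealProd.symm

instance isProbabilityMeasure_stdComplexGaussian : IsProbabilityMeasure stdComplexGaussian :=
  Measure.isProbabilityMeasure_map Complex.measurableEquivRealProd.symm.measurable.aemeasurable

/-- The norm `‖∑ⱼ γⱼ ⊗ xⱼ‖_{G(X)} = (E ‖∑ⱼ γⱼ xⱼ‖²)^{1/2}` of a finite family `x` in `X`, where the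
`γⱼ` are independent standard complex Gaussian variables. They are realised as the coordinate
functions on `ℂ^ι` with the product of the standard complex Gaussian laws. -/
noncomputable def gaussianNorm {ι : Type*} [Fintype ι] {X : Type*} [NormedAddCommGroup X]
    [NormedSpace ℂ X] (x : ι → X) : ℝ :=
  (eLpNorm (fun ω : ι → ℂ => ∑ j, ω j • x j) 2
    (Measure.pi fun _ : ι => stdComplexGaussian)).toReal

/-- `C` is an admissible constant in the definition of `γ`-boundedness of the set `E ⊆ B(X)`. -/
def IsGammaBound {X : Type*} [NormedAddCommGroup X] [NormedSpace ℂ X]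
    (E : Set (X →L[ℂ] X)) (C : ℝ) : Prop :=
  0 ≤ C ∧ ∀ (n : ℕ) (V : Fin n → X →L[ℂ] X) (x : Fin n → X), (∀ j, V j ∈ E) →
    gaussianNorm (fun j => V j (x j)) ≤ C * gaussianNorm x

/-- The set `E ⊆ B(X)` is `γ`-bounded. -/
def IsGammaBoundedSet {X : Type*} [NormedAddCommGroup X] [NormedSpace ℂ X]
    (E : Set (X →L[ℂ] X)) : Prop :=
  ∃ C : ℝ, IsGammaBound E C

/-- The `γ`-boundedness constant of `E`: the smallest admissible constant. -/
noncomputable def gammaConstSet {X : Type*} [NormedAddCommGroup X] [NormedSpace ℂ X]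
    (E : Set (X →L[ℂ] X)) : ℝ :=
  sInf {C : ℝ | IsGammaBound E C}

/-- A function with values in `B(X)` is `γ`-bounded if its range is. -/
def IsGammaBounded {I : Type*} {X : Type*} [NormedAddCommGroup X] [NormedSpace ℂ X]
    (A : I → X →L[ℂ] X) : Prop :=
  IsGammaBoundedSet (Set.range A)

/-- The `γ`-boundedness constant of a function with values in `B(X)`. -/
noncomputable def gammaConst {I : Type*} {X : Type*} [NormedAddCommGroup X] [NormedSpace ℂ X]
    (A : I → X →L[ℂ] X) : ℝ :=
  gammaConstSet (Set.range A)

universe u v w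

/-- `φ(s,t) = (a₂(t) | a₁(s))_K` for almost every `(s,t)`. The inner product `( · | · )_K` is linear
in its left argument, whereas Mathlib's `inner` is linear in its right argument. -/
def IsV2Factorization {Ω₁ : Type u} {Ω₂ : Type v} [MeasurableSpace Ω₁] [MeasurableSpace Ω₂]
    (μ₁ : Measure Ω₁) (μ₂ : Measure Ω₂) (φ : Ω₁ × Ω₂ → ℂ)
    {K : Type w} [NormedAddCommGroup K] [InnerProductSpace ℂ K]
    (a₁ : Lp K ∞ μ₁) (a₂ : Lp K ∞ μ₂) : Prop :=
  ∀ᵐ p ∂(μ₁.prod μ₂), φ p = inner ℂ (a₁ p.1) (a₂ p.2)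

/-- The set of all values `‖a₁‖_∞ ‖a₂‖_∞`, over all factorizations of `φ` through complex Hilbert
spaces `K` (of universe level `w`). -/
def v2FactorizationNorms {Ω₁ : Type u} {Ω₂ : Type v} [MeasurableSpace Ω₁] [MeasurableSpace Ω₂]
    (μ₁ : Measure Ω₁) (μ₂ : Measure Ω₂) (φ : Ω₁ × Ω₂ → ℂ) : Set ℝ :=
  {r : ℝ | ∃ (K : Type w) (_ : NormedAddCommGroup K) (_ : InnerProductSpace ℂ K)
    (_ : CompleteSpace K) (a₁ : Lp K ∞ μ₁) (a₂ : Lp K ∞ μ₂),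
    IsV2Factorization μ₁ μ₂ φ a₁ a₂ ∧ r = ‖a₁‖ * ‖a₂‖}

/-- Membership in `𝒱₂(Ω₁ × Ω₂)`: `φ` is in `L^∞(Ω₁ × Ω₂)` and has a factorization. -/
def MemV2 {Ω₁ : Type u} {Ω₂ : Type v} [MeasurableSpace Ω₁] [MeasurableSpace Ω₂]
    (μ₁ : Measure Ω₁) (μ₂ : Measure Ω₂) (φ : Ω₁ × Ω₂ → ℂ) : Prop :=
  MemLp φ ∞ (μ₁.prod μ₂) ∧ (v2FactorizationNorms.{u, v, w} μ₁ μ₂ φ).Nonempty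

/-- The norm `ν₂(φ)`: the infimum of `‖a₁‖_∞ ‖a₂‖_∞` over all factorizations of `φ`
(meaningful for `φ` in `𝒱₂`). -/
noncomputable def nu2 {Ω₁ : Type u} {Ω₂ : Type v} [MeasurableSpace Ω₁] [MeasurableSpace Ω₂]
    (μ₁ : Measure Ω₁) (μ₂ : Measure Ω₂) (φ : Ω₁ × Ω₂ → ℂ) : ℝ :=
  sInf (v2FactorizationNorms.{u, v, w} μ₁ μ₂ φ)

/-! The kernel is shown to be a Schur multiplier, which forces a Hilbert space factorization. On
finite sets, pair it with a matrix `c k * u k i * d i`, `u` a contraction. The result is `∑ k, c k *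
xs (B k (∑ i, u k i • A i (d i • x)))`. The two γ-bounds handle `A` and `B`, and `u` does not
increase Gaussian norms, because Gaussian laws are invariant under isometries and contractions
dilate to isometries. This gives the constant `C = γ(A)γ(B)‖x‖‖xs‖` (`norm_sum_bilinear_le`).

Hahn–Banach separation from the cone of blocks of positive semidefinite matrices turns this bound
into approximate positive completions with diagonal about `C` (`SchurBound.mem_closure_blockCone`).
An ultrafilter limit and a Gram representation then factor the kernel at every point, with vectors
of norm at most `√C` (`exists_inner_factorization`).

These vectors need not be measurable, nor their space separable. Since `s ↦ A s x` has essentially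
separable range, projecting onto a suitable separable subspace repairs both
(`exists_aestronglyMeasurable_factorization`). -/

/-! ### Invariance of complex Gaussian laws under isometries. -/

/-- Every real-linear functional on `ℂ^ι` has the form `ω ↦ Re (∑ i, ξ i * ω i)`. -/
lemma exists_eq_re_sum {ι : Type*} [Fintype ι] (L : (ι → ℂ) →ₗ[ℝ] ℝ) :
    ∃ ξ : ι → ℂ, ∀ ω : ι → ℂ, L ω = (∑ i, ξ i * ω i).re := by
  classical
  -- The minus sign comes from Re((α + iβ)(x + iy)) = αx − βy.
  refine ⟨fun i => ⟨L (Pi.single i 1), -L (Pi.single i Complex.I)⟩, fun ω => ?_⟩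
  have h : ω = ∑ i, ((ω i).re • (Pi.single i 1 : ι → ℂ)
      + (ω i).im • (Pi.single i Complex.I : ι → ℂ)) := by
    ext j
    simp [Finset.sum_apply, Pi.single_apply, Finset.sum_add_distrib]
  conv_lhs => rw [h]
  simp only [map_sum, map_add, map_smul, smul_eq_mul, Complex.re_sum, Complex.mul_re]
  exact Finset.sum_congr rfl fun i _ => by ring

lemma charFunDual_stdComplexGaussian (L : StrongDual ℝ ℂ) (ξ : ℂ)
    (hL : ∀ z, L z = (ξ * z).re) :
    charFunDual stdComplexGaussian L = Complex.exp (-(‖ξ‖ ^ 2 / 4 : ℝ)) := by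
  have key : ∀ a : ℝ, ∫ x : ℝ, Complex.exp (((a * x : ℝ) : ℂ) * Complex.I)
      ∂(gaussianReal 0 (1 / 2)) = Complex.exp (-(a ^ 2 / 4 : ℝ)) := by
    intro a
    have := charFun_gaussianReal (μ := 0) (v := 1 / 2) a
    rw [charFun_apply_real] at this
    rw [show (fun x : ℝ => Complex.exp (((a * x : ℝ) : ℂ) * Complex.I))
      = fun x : ℝ => Complex.exp (a * x * Complex.I) by ext; push_cast; rfl, this]
    congr 1
    push_cast
    simp
    ring
  rw [charFunDual_apply, stdComplexGaussian, integral_map_equiv]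
  have : ∀ p : ℝ × ℝ, Complex.exp ((L (Complex.measurableEquivRealProd.symm p) : ℂ) * Complex.I)
      = Complex.exp (((ξ.re * p.1 : ℝ) : ℂ) * Complex.I)
        * Complex.exp (((-ξ.im * p.2 : ℝ) : ℂ) * Complex.I) := by
    intro p
    rw [hL, ← Complex.exp_add, ← add_mul, ← Complex.ofReal_add]
    congr 3
    simp [Complex.mul_re]
    ring
  simp_rw [this]
  rw [integral_prod_mul (fun x : ℝ => Complex.exp (((ξ.re * x : ℝ) : ℂ) * Complex.I))
    (fun x : ℝ => Complex.exp (((-ξ.im * x : ℝ) : ℂ) * Complex.I)), key, key,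
    ← Complex.exp_add, Complex.sq_norm, Complex.normSq_apply]
  congr 1
  push_cast
  ring

/-- Only the Euclidean norm of `ξ` enters; this is the source of the isometric invariance. -/
lemma charFunDual_pi_stdComplexGaussian {ι : Type*} [Fintype ι] (L : StrongDual ℝ (ι → ℂ))
    (ξ : ι → ℂ) (hL : ∀ ω, L ω = (∑ i, ξ i * ω i).re) :
    charFunDual (Measure.pi fun _ : ι => stdComplexGaussian) L
      = Complex.exp (-((∑ i, ‖ξ i‖ ^ 2) / 4 : ℝ)) := by
  classical
  rw [charFunDual_pi, Finset.sum_div, Complex.ofReal_sum, ← Finset.sum_neg_distrib,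
    Complex.exp_sum]
  refine Finset.prod_congr rfl fun i _ => ?_
  refine charFunDual_stdComplexGaussian _ (ξ i) fun z => ?_
  simp [hL, Pi.single_apply]

lemma star_dotProduct_self_eq {τ : Type*} [Fintype τ] (z : τ → ℂ) :
    star z ⬝ᵥ z = ((∑ t, ‖z t‖ ^ 2 : ℝ) : ℂ) := by
  simp [dotProduct, ← Complex.conj_mul']

/-- For `Vᴴ * V = 1`, the map `ξ ↦ V ξ` preserves the Euclidean norm. -/
lemma sum_norm_sq_mulVec_of_isometry {ι κ : Type*} [Fintype ι] [Fintype κ] [DecidableEq ι]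
    {V : Matrix κ ι ℂ} (hV : V.conjTranspose * V = 1) (ξ : ι → ℂ) :
    ∑ k, ‖V.mulVec ξ k‖ ^ 2 = ∑ i, ‖ξ i‖ ^ 2 := by
  have h : star (V.mulVec ξ) ⬝ᵥ V.mulVec ξ = star ξ ⬝ᵥ ξ := by
    rw [Matrix.star_mulVec, ← Matrix.dotProduct_mulVec, Matrix.mulVec_mulVec, hV,
      Matrix.one_mulVec]
  rw [star_dotProduct_self_eq, star_dotProduct_self_eq] at h
  exact_mod_cast h

/-- Composing a functional with `ω ↦ ω V` replaces its coefficients `ξ` by `V ξ`, of the same norm,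
so the characteristic functions agree. -/
lemma map_vecMul_pi_stdComplexGaussian {ι κ : Type*} [Fintype ι] [Fintype κ] [DecidableEq ι]
    {V : Matrix κ ι ℂ} (hV : V.conjTranspose * V = 1) :
    (Measure.pi fun _ : κ => stdComplexGaussian).map (fun ω => V.vecMul ω)
      = Measure.pi fun _ : ι => stdComplexGaussian := by
  let T : (κ → ℂ) →L[ℝ] (ι → ℂ) := LinearMap.toContinuousLinearMap
    (V.vecMulLinear.restrictScalars ℝ)
  have hT : ∀ ω, T ω = V.vecMul ω := fun ω => rfl
  have : (fun ω => V.vecMul ω) = T := rfl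
  rw [this]
  refine Measure.ext_of_charFunDual (funext fun L => ?_)
  obtain ⟨ξ, hξ⟩ := exists_eq_re_sum (L : (ι → ℂ) →ₗ[ℝ] ℝ)
  rw [charFunDual_map, charFunDual_pi_stdComplexGaussian L ξ hξ,
    charFunDual_pi_stdComplexGaussian (L.comp T) (V.mulVec ξ), sum_norm_sq_mulVec_of_isometry hV]
  intro ω
  rw [ContinuousLinearMap.comp_apply]
  refine (hξ (T ω)).trans ?_
  rw [hT]
  change (ξ ⬝ᵥ V.vecMul ω).re = (V.mulVec ξ ⬝ᵥ ω).re
  rw [dotProduct_comm, ← Matrix.dotProduct_mulVec, dotProduct_comm]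

/-! ### Gaussian norms and γ-boundedness. -/

section gaussianNorm

open scoped ComplexOrder MatrixOrder

variable {ι κ : Type*} [Fintype ι] [Fintype κ] {X : Type*} [NormedAddCommGroup X] [NormedSpace ℂ X]

lemma gaussianNorm_isometry [DecidableEq ι] {V : Matrix κ ι ℂ} (hV : V.conjTranspose * V = 1)
    (z : ι → X) : gaussianNorm (fun k => ∑ i, V k i • z i) = gaussianNorm z := by
  have hm : Measurable (fun ω : κ → ℂ => V.vecMul ω) := by
    unfold Matrix.vecMul dotProduct
    fun_prop
  have hc : Continuous (fun ω : ι → ℂ => ∑ j, ω j • z j) := by fun_prop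
  unfold gaussianNorm
  rw [← map_vecMul_pi_stdComplexGaussian hV, eLpNorm_map_measure _ hm.aemeasurable]
  · congr 2
    ext ω
    simp only [Function.comp, Matrix.vecMul, dotProduct, Finset.smul_sum, Finset.sum_smul,
      smul_smul]
    exact Finset.sum_comm
  · rw [map_vecMul_pi_stdComplexGaussian hV]
    exact hc.aestronglyMeasurable

lemma memLp_id_stdComplexGaussian : MemLp (fun z : ℂ => z) 2 stdComplexGaussian := by
  have h : MemLp (fun x : ℝ => x) 2 (gaussianReal 0 (1 / 2)) := memLp_id_gaussianReal' 2 (by simp)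
  rw [stdComplexGaussian, memLp_map_measure_iff (by fun_prop)
    Complex.measurableEquivRealProd.symm.measurable.aemeasurable]
  have h1 : MemLp (fun p : ℝ × ℝ => p.1) 2
      ((gaussianReal 0 (1 / 2)).prod (gaussianReal 0 (1 / 2))) :=
    h.comp_measurePreserving measurePreserving_fst
  have h2 : MemLp (fun p : ℝ × ℝ => p.2) 2
      ((gaussianReal 0 (1 / 2)).prod (gaussianReal 0 (1 / 2))) :=
    h.comp_measurePreserving measurePreserving_snd
  exact (memLp_re_im_iff (K := ℂ)).1 ⟨h1, h2⟩

lemma memLp_sum_smul (z : ι → X) :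
    MemLp (fun ω : ι → ℂ => ∑ j, ω j • z j) 2 (Measure.pi fun _ : ι => stdComplexGaussian) := by
  refine memLp_finsetSum _ fun j _ => ?_
  have h : MemLp (fun ω : ι → ℂ => ω j) 2 (Measure.pi fun _ : ι => stdComplexGaussian) :=
    memLp_id_stdComplexGaussian.comp_measurePreserving
      (measurePreserving_eval (fun _ : ι => stdComplexGaussian) j)
  exact ((ContinuousLinearMap.id ℂ ℂ).smulRight (z j)).comp_memLp' h

lemma gaussianNorm_nonneg (z : ι → X) : 0 ≤ gaussianNorm z := ENNReal.toReal_nonneg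

lemma gaussianNorm_add_le (z z' : ι → X) :
    gaussianNorm (fun i => z i + z' i) ≤ gaussianNorm z + gaussianNorm z' := by
  unfold gaussianNorm
  rw [← ENNReal.toReal_add (memLp_sum_smul z).2.ne (memLp_sum_smul z').2.ne]
  refine ENNReal.toReal_mono
    (ENNReal.add_ne_top.2 ⟨(memLp_sum_smul z).2.ne, (memLp_sum_smul z').2.ne⟩) ?_
  refine le_trans (le_of_eq ?_)
    (eLpNorm_add_le (memLp_sum_smul z).1 (memLp_sum_smul z').1 (by simp))
  congr 1
  ext ω
  simp [Finset.sum_add_distrib]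

lemma gaussianNorm_clm_le {Y : Type*} [NormedAddCommGroup Y] [NormedSpace ℂ Y] (T : X →L[ℂ] Y)
    (z : ι → X) : gaussianNorm (fun i => T (z i)) ≤ ‖T‖ * gaussianNorm z := by
  unfold gaussianNorm
  have h : eLpNorm (fun ω : ι → ℂ => ∑ j, ω j • T (z j)) 2
      (Measure.pi fun _ : ι => stdComplexGaussian) ≤ ENNReal.ofReal ‖T‖ *
      eLpNorm (fun ω : ι → ℂ => ∑ j, ω j • z j) 2
      (Measure.pi fun _ : ι => stdComplexGaussian) := by
    refine eLpNorm_le_mul_eLpNorm_of_ae_le_mul (.of_forall fun ω => ?_) _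
    simpa using T.le_opNorm (∑ j, ω j • z j)
  have := ENNReal.toReal_mono (ENNReal.mul_ne_top ENNReal.ofReal_ne_top (memLp_sum_smul z).2.ne) h
  rwa [ENNReal.toReal_mul, ENNReal.toReal_ofReal (norm_nonneg _)] at this

lemma gaussianNorm_smul (c : ℂ) (z : ι → X) :
    gaussianNorm (fun i => c • z i) = ‖c‖ * gaussianNorm z := by
  unfold gaussianNorm
  have : (fun ω : ι → ℂ => ∑ j, ω j • c • z j) = c • fun ω : ι → ℂ => ∑ j, ω j • z j := by
    ext ω
    simp [Finset.smul_sum, smul_smul, mul_comm]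
  rw [this, eLpNorm_const_smul, ENNReal.toReal_mul, toReal_enorm]

/-- The Gaussian norm of `u z` is at most that of `z` if `u` is a contraction. -/
lemma gaussianNorm_contraction_le [DecidableEq ι] {u : Matrix κ ι ℂ}
    (hu : (1 - u.conjTranspose * u).PosSemidef) (z : ι → X) :
    gaussianNorm (fun k => ∑ i, u k i • z i) ≤ gaussianNorm z := by
  classical
  obtain ⟨R, hR⟩ : ∃ R : Matrix ι ι ℂ, 1 - u.conjTranspose * u = R.conjTranspose * R :=
    CStarAlgebra.nonneg_iff_eq_star_mul_self.1 hu.nonneg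
  -- dilation of `u` to an isometry, twice, with a sign
  have hiso : ∀ ε : ℂ, star ε * ε = 1 →
      gaussianNorm (fun k : κ ⊕ ι => ∑ i, Matrix.fromRows u (ε • R) k i • z i)
        = gaussianNorm z := by
    intro ε hε
    refine gaussianNorm_isometry ?_ z
    rw [Matrix.conjTranspose_fromRows_eq_fromCols_conjTranspose, Matrix.fromCols_mul_fromRows,
      Matrix.conjTranspose_smul, Matrix.smul_mul, Matrix.mul_smul, smul_smul, hε, one_smul, ← hR]
    simp
  have hemb : gaussianNorm (fun k : κ ⊕ ι => ∑ l,
      Matrix.fromRows (1 : Matrix κ κ ℂ) (0 : Matrix ι κ ℂ) k l • ∑ i, u l i • z i)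
      = gaussianNorm (fun k => ∑ i, u k i • z i) := by
    refine gaussianNorm_isometry ?_ _
    rw [Matrix.conjTranspose_fromRows_eq_fromCols_conjTranspose, Matrix.fromCols_mul_fromRows]
    simp
  have h2 := gaussianNorm_add_le
    (fun k : κ ⊕ ι => ∑ i, Matrix.fromRows u ((1 : ℂ) • R) k i • z i)
    (fun k : κ ⊕ ι => ∑ i, Matrix.fromRows u ((-1 : ℂ) • R) k i • z i)
  rw [hiso 1 (by simp), hiso (-1) (by simp)] at h2
  -- The blocks `R` and `-R` cancel, leaving twice `u` padded by zero rows; padding is isometric by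
  -- `hemb`.
  have h3 : (fun k : κ ⊕ ι => ∑ i, Matrix.fromRows u ((1 : ℂ) • R) k i • z i
      + ∑ i, Matrix.fromRows u ((-1 : ℂ) • R) k i • z i)
      = fun k => (2 : ℂ) • ∑ l,
      Matrix.fromRows (1 : Matrix κ κ ℂ) (0 : Matrix ι κ ℂ) k l • ∑ i, u l i • z i := by
    ext k
    rcases k with k | k
    · simp [Matrix.one_apply, two_smul]
    · simp
  rw [h3, gaussianNorm_smul, hemb] at h2
  simp only [Complex.norm_ofNat] at h2
  linarith

lemma gaussianNorm_comp_equiv (e : κ ≃ ι) (z : ι → X) :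
    gaussianNorm (fun k => z (e k)) = gaussianNorm z := by
  classical
  rw [← gaussianNorm_isometry (V := Matrix.of fun k i => if e k = i then (1 : ℂ) else 0) _ z]
  · simp
  · ext i j
    simp only [Matrix.mul_apply, Matrix.conjTranspose_apply, Matrix.of_apply, Matrix.one_apply]
    rw [← e.symm.sum_comp]
    simp [eq_comm]

lemma gaussianNorm_one [Unique ι] : gaussianNorm (fun _ : ι => (1 : ℂ)) = 1 := by
  have h2 : MemLp (fun x : ℝ => x) 2 (gaussianReal 0 (1 / 2)) := memLp_id_gaussianReal' 2 (by simp)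
  have hvar : ∫ x, x ^ 2 ∂(gaussianReal 0 (1 / 2)) = 1 / 2 := by
    have := variance_id_gaussianReal (μ := 0) (v := 1 / 2)
    rw [variance_of_integral_eq_zero (by fun_prop) (by simp)] at this
    simpa using this
  have hint := h2.integrable_sq
  have hI : ∫ z, ‖z‖ ^ 2 ∂stdComplexGaussian = 1 := by
    rw [stdComplexGaussian, integral_map_equiv]
    have : ∀ p : ℝ × ℝ, ‖Complex.measurableEquivRealProd.symm p‖ ^ 2 = p.1 ^ 2 + p.2 ^ 2 := by
      intro p
      rw [Complex.sq_norm, Complex.normSq_apply]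
      simp [sq]
    simp_rw [this]
    rw [integral_add (hint.comp_fst _) (hint.comp_snd _), integral_fun_fst (fun x : ℝ => x ^ 2),
      integral_fun_snd (fun x : ℝ => x ^ 2), hvar]
    norm_num
  have h1 : eLpNorm (fun z : ℂ => z) 2 stdComplexGaussian = 1 := by
    rw [MemLp.eLpNorm_eq_integral_rpow_norm (by simp) (by simp) memLp_id_stdComplexGaussian]
    simp [hI]
  have := eLpNorm_comp_measurePreserving (p := 2) memLp_id_stdComplexGaussian.1
    (measurePreserving_eval (fun _ : ι => stdComplexGaussian) default)
  unfold gaussianNorm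
  simp only [Fintype.sum_unique, smul_eq_mul, mul_one]
  rw [show (fun ω : ι → ℂ => ω default) = (fun z : ℂ => z) ∘ Function.eval default from rfl,
    this, h1]
  simp

/-- A normalized `c` is a one-column isometry, so only a single Gaussian variable remains. -/
lemma gaussianNorm_smul_const (c : ι → ℂ) (x : X) :
    gaussianNorm (fun i => c i • x) = √(∑ i, ‖c i‖ ^ 2) * ‖x‖ := by
  set r : ℝ := √(∑ i, ‖c i‖ ^ 2) with hr
  have hS : 0 ≤ ∑ i, ‖c i‖ ^ 2 := Finset.sum_nonneg fun _ _ => by positivity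
  have hr2 : r ^ 2 = ∑ i, ‖c i‖ ^ 2 := Real.sq_sqrt hS
  rcases eq_or_ne r 0 with h0 | h0
  · have hc : ∀ i, c i = 0 := by
      rw [h0, sq, zero_mul, eq_comm, Finset.sum_eq_zero_iff_of_nonneg (fun _ _ => by positivity)]
        at hr2
      intro i
      simpa using hr2 i (Finset.mem_univ i)
    simp [h0, hc, gaussianNorm]
  · have hiso := gaussianNorm_isometry (V := Matrix.of fun (k : ι) (_ : Unit) => c k / (r : ℂ))
      (by
        ext i j
        simp only [Matrix.mul_apply, Matrix.conjTranspose_apply, Matrix.of_apply, Matrix.one_apply,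
          if_true, star_div₀, RCLike.star_def, Complex.conj_ofReal]
        have : ∀ k, (starRingEnd ℂ) (c k) / r * (c k / r) = ((‖c k‖ ^ 2 / r ^ 2 : ℝ) : ℂ) := by
          intro k
          push_cast
          rw [← Complex.conj_mul']
          field_simp
        simp_rw [this]
        rw [← Complex.ofReal_sum, ← Finset.sum_div, ← hr2, div_self (by positivity)]
        simp) (fun _ : Unit => (r : ℂ) • x)
    have hrC : (r : ℂ) ≠ 0 := by exact_mod_cast h0
    simp only [Matrix.of_apply, Finset.univ_unique, Finset.sum_const, Finset.card_singleton,
      one_smul, smul_smul, div_mul_cancel₀ _ hrC] at hiso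
    rw [hiso, gaussianNorm_smul, Complex.norm_real, Real.norm_of_nonneg (Real.sqrt_nonneg _)]
    congr 1
    have h1 := gaussianNorm_one (ι := Unit)
    unfold gaussianNorm at h1 ⊢
    simp only [Finset.univ_unique, Finset.sum_singleton] at h1 ⊢
    have : eLpNorm (fun ω : Unit → ℂ => ω default • x) 2
        (Measure.pi fun _ : Unit => stdComplexGaussian)
        = eLpNorm (fun ω : Unit → ℂ => ‖x‖ • (ω default • (1 : ℂ))) 2
        (Measure.pi fun _ : Unit => stdComplexGaussian) := by
      refine eLpNorm_congr_norm_ae (.of_forall fun ω => ?_)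
      simp [norm_smul, mul_comm]
    rw [this]
    have h3 := eLpNorm_const_smul (p := 2) (‖x‖) (fun ω : Unit → ℂ => (ω default • (1 : ℂ)))
      (Measure.pi fun _ : Unit => stdComplexGaussian)
    rw [show (fun ω : Unit → ℂ => ‖x‖ • (ω default • (1 : ℂ)))
      = ‖x‖ • (fun ω : Unit → ℂ => (ω default • (1 : ℂ))) from rfl, h3, ENNReal.toReal_mul, h1]
    simp

/-- Functionals are `ℓ²`-bounded with respect to the Gaussian norm. -/
lemma sqrt_sum_norm_sq_dual_le (xs : StrongDual ℂ X) (z : ι → X) :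
    √(∑ i, ‖xs (z i)‖ ^ 2) ≤ ‖xs‖ * gaussianNorm z := by
  have h := gaussianNorm_smul_const (fun i => xs (z i)) (1 : ℂ)
  simp only [smul_eq_mul, mul_one, norm_one] at h
  rw [← h]
  exact gaussianNorm_clm_le xs z

lemma IsGammaBound.gaussianNorm_le {E : Set (X →L[ℂ] X)} {C : ℝ} (h : IsGammaBound E C)
    (V : ι → X →L[ℂ] X) (hV : ∀ i, V i ∈ E) (z : ι → X) :
    gaussianNorm (fun i => V i (z i)) ≤ C * gaussianNorm z := by
  let e := (Fintype.equivFin ι).symm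
  have := h.2 _ (fun k => V (e k)) (fun k => z (e k)) (fun k => hV _)
  rwa [gaussianNorm_comp_equiv e (fun i => V i (z i)), gaussianNorm_comp_equiv e z] at this

/-- The infimum is attained: divide by `gaussianNorm z` when it is positive; when it vanishes, every
constant gives the same inequality. -/
lemma IsGammaBoundedSet.isGammaBound {E : Set (X →L[ℂ] X)} (h : IsGammaBoundedSet E) :
    IsGammaBound E (gammaConstSet E) := by
  have hb : BddBelow {C : ℝ | IsGammaBound E C} := ⟨0, fun C hC => hC.1⟩
  refine ⟨le_csInf h fun C hC => hC.1, fun n V z hV => ?_⟩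
  rcases (gaussianNorm_nonneg z).eq_or_lt with h0 | h0
  · obtain ⟨C, hC⟩ := h
    simpa [← h0] using hC.2 n V z hV
  · rw [← div_le_iff₀ h0]
    exact le_csInf h fun C hC => (div_le_iff₀ h0).2 (hC.2 n V z hV)

/-- The bilinear estimate behind the factorization of `(s, t) ↦ ⟨B(t) A(s) x, x*⟩`. -/
lemma norm_sum_bilinear_le [DecidableEq ι] {E F : Set (X →L[ℂ] X)} {a b : ℝ}
    (hE : IsGammaBound E a) (hF : IsGammaBound F b) (A : ι → X →L[ℂ] X) (B : κ → X →L[ℂ] X)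
    (hA : ∀ i, A i ∈ E) (hB : ∀ k, B k ∈ F) {u : Matrix κ ι ℂ}
    (hu : (1 - u.conjTranspose * u).PosSemidef) (c : κ → ℂ) (d : ι → ℂ) (x : X)
    (xs : StrongDual ℂ X) :
    ‖∑ k, ∑ i, c k * u k i * d i * xs (B k (A i x))‖
      ≤ a * b * ‖x‖ * ‖xs‖ * (√(∑ k, ‖c k‖ ^ 2) * √(∑ i, ‖d i‖ ^ 2)) := by
  -- Read as a composition: `d` scales `x`, then `A`, `u`, `B`, `xs` act in turn, and `c` is paired
  -- with the result. Each factor costs its own bound.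
  have hrw : ∀ k, ∑ i, c k * u k i * d i * xs (B k (A i x))
      = c k * xs (B k (∑ i, u k i • A i (d i • x))) := by
    intro k
    simp only [map_sum, map_smul, Finset.mul_sum, smul_eq_mul]
    exact Finset.sum_congr rfl fun i _ => by ring
  simp_rw [hrw]
  have h1 : ‖∑ k, c k * xs (B k (∑ i, u k i • A i (d i • x)))‖
      ≤ √(∑ k, ‖c k‖ ^ 2) * √(∑ k, ‖xs (B k (∑ i, u k i • A i (d i • x)))‖ ^ 2) := by
    refine (norm_sum_le _ _).trans ?_
    simp_rw [norm_mul]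
    exact Real.sum_mul_le_sqrt_mul_sqrt _ _ _
  have h2 := sqrt_sum_norm_sq_dual_le xs (fun k => B k (∑ i, u k i • A i (d i • x)))
  have h3 := hF.gaussianNorm_le B hB (fun k => ∑ i, u k i • A i (d i • x))
  have h4 := gaussianNorm_contraction_le hu (fun i => A i (d i • x))
  have h5 := hE.gaussianNorm_le A hA (fun i => d i • x)
  rw [gaussianNorm_smul_const] at h5
  have hb := hF.1
  calc _ ≤ √(∑ k, ‖c k‖ ^ 2) * (‖xs‖ * (b * (a * (√(∑ i, ‖d i‖ ^ 2) * ‖x‖)))) := by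
        refine h1.trans ?_
        gcongr
        refine h2.trans ?_
        gcongr
        refine h3.trans ?_
        gcongr
        exact h4.trans h5
    _ = _ := by ring

end gaussianNorm

/-! ### Schur multipliers and positive completions on finite sets. -/

section Kernel

open scoped ComplexOrder MatrixOrder

lemma posSemidef_one_sub_of_contraction {ι κ : Type*} [Fintype ι] [Fintype κ] [DecidableEq ι]
    {u : Matrix κ ι ℂ} (hu : ∀ x : ι → ℂ, ∑ k, ‖u.mulVec x k‖ ^ 2 ≤ ∑ i, ‖x i‖ ^ 2) :
    (1 - u.conjTranspose * u).PosSemidef := by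
  refine Matrix.PosSemidef.of_dotProduct_mulVec_nonneg ?_ fun x => ?_
  · exact Matrix.isHermitian_one.sub (Matrix.isHermitian_conjTranspose_mul_self u)
  · rw [Matrix.sub_mulVec, Matrix.one_mulVec, dotProduct_sub, ← Matrix.mulVec_mulVec,
      Matrix.dotProduct_mulVec, ← Matrix.star_mulVec, star_dotProduct_self_eq,
      star_dotProduct_self_eq, ← Complex.ofReal_sub]
    exact_mod_cast sub_nonneg.2 (hu x)

/-- `φ` is bounded by `C` in duality with the matrices `(c k * u k i * d i)`, with `u` a
contraction: `C` dominates the Schur multiplier norm of `φ`. -/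
def SchurBound {ι κ : Type*} [Fintype ι] [Fintype κ] [DecidableEq ι] (φ : ι → κ → ℂ)
    (C : ℝ) : Prop :=
  ∀ u : Matrix κ ι ℂ, (1 - u.conjTranspose * u).PosSemidef → ∀ (c : κ → ℂ) (d : ι → ℂ),
    ‖∑ k, ∑ i, c k * u k i * d i * φ i k‖ ≤ C * (√(∑ k, ‖c k‖ ^ 2) * √(∑ i, ‖d i‖ ^ 2))

/-- The off-diagonal blocks of positive semidefinite matrices, together with bounds for their
diagonals. -/
def blockCone (ι κ : Type*) : Set ((ι × κ → ℂ) × (ι ⊕ κ → ℝ)) :=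
  {x | ∃ G : Matrix (ι ⊕ κ) (ι ⊕ κ) ℂ, G.PosSemidef ∧ (∀ p, G (.inl p.1) (.inr p.2) = x.1 p) ∧
    ∀ p, (G p p).re ≤ x.2 p}

lemma convex_blockCone {ι κ : Type*} : Convex ℝ (blockCone ι κ) := by
  rintro x ⟨G, hG, hG1, hG2⟩ y ⟨G', hG', hG1', hG2'⟩ a b ha hb -
  refine ⟨(a : ℂ) • G + (b : ℂ) • G', (hG.smul (by exact_mod_cast ha)).add
    (hG'.smul (by exact_mod_cast hb)), fun p => ?_, fun p => ?_⟩
  · simp [hG1, hG1']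
  · simp only [Matrix.add_apply, Matrix.smul_apply, smul_eq_mul, Complex.add_re,
      Complex.re_ofReal_mul, Prod.snd_add, Prod.smul_snd, Pi.add_apply, Pi.smul_apply]
    gcongr
    · exact hG2 p
    · exact hG2' p

lemma smul_mem_blockCone {ι κ : Type*} {x : (ι × κ → ℂ) × (ι ⊕ κ → ℝ)} (hx : x ∈ blockCone ι κ)
    {r : ℝ} (hr : 0 ≤ r) : r • x ∈ blockCone ι κ := by
  obtain ⟨G, hG, hG1, hG2⟩ := hx
  refine ⟨(r : ℂ) • G, hG.smul (by exact_mod_cast hr), fun p => by simp [hG1], fun p => ?_⟩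
  simp only [Matrix.smul_apply, smul_eq_mul, Complex.re_ofReal_mul, Prod.smul_snd, Pi.smul_apply]
  gcongr
  exact hG2 p

variable {ι κ : Type*} [Fintype ι] [Fintype κ] [DecidableEq ι] {φ : ι → κ → ℂ} {C : ℝ}

/-- Positivity of the form says that `m`, rescaled by the weights, is twice a contraction;
`SchurBound` then applies to it with `√w` as the two vectors. -/
lemma SchurBound.nonneg_of_quadratic_form_nonneg (hφ : SchurBound φ C) (hC : 0 ≤ C)
    (m : ι × κ → ℂ) (w : ι ⊕ κ → ℝ) (hw : ∀ p, 0 < w p)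
    (h : ∀ z : ι ⊕ κ → ℂ, 0 ≤ (∑ p : ι × κ,
      m p * (z (.inl p.1) * star (z (.inr p.2)))).re + ∑ p, w p * ‖z p‖ ^ 2) :
    0 ≤ (∑ p : ι × κ, m p * φ p.1 p.2).re + C * ∑ p, w p := by
  have hs : ∀ p, ((√(w p) : ℝ) : ℂ) ≠ 0 := fun p =>
    Complex.ofReal_ne_zero.2 (Real.sqrt_pos.2 (hw p)).ne'
  let u : Matrix κ ι ℂ := Matrix.of fun k i =>
    m (i, k) / (2 * (√(w (.inl i)) : ℝ) * (√(w (.inr k)) : ℝ))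
  have hu : (1 - u.conjTranspose * u).PosSemidef := by
    refine posSemidef_one_sub_of_contraction fun x => ?_
    -- This test vector turns the form into −2‖ux‖² + ‖x‖² + ‖ux‖².
    have h1 := h (Sum.elim (fun i => x i / (√(w (.inl i)) : ℝ))
      (fun k => -(u.mulVec x k) / (√(w (.inr k)) : ℝ)))
    have hn : ∀ (p : ι ⊕ κ) (y : ℂ), w p * ‖y / (√(w p) : ℝ)‖ ^ 2 = ‖y‖ ^ 2 := by
      intro p y
      rw [norm_div, div_pow, Complex.norm_real, Real.norm_of_nonneg (Real.sqrt_nonneg _),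
        Real.sq_sqrt (hw p).le, mul_div_cancel₀ _ (hw p).ne']
    have hsum : ∑ p : ι × κ, m p * (x p.1 / (√(w (.inl p.1)) : ℝ)
        * star (-(u.mulVec x p.2) / ((√(w (.inr p.2)) : ℝ) : ℂ)))
        = ((-2 * ∑ k, ‖u.mulVec x k‖ ^ 2 : ℝ) : ℂ) := by
      rw [Fintype.sum_prod_type_right, Finset.mul_sum, Complex.ofReal_sum]
      refine Finset.sum_congr rfl fun k _ => ?_
      have hk : ∑ i, m (i, k) * (x i / (√(w (.inl i)) : ℝ)
          * star (-(u.mulVec x k) / ((√(w (.inr k)) : ℝ) : ℂ)))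
          = -2 * ((∑ i, u k i * x i) * (starRingEnd ℂ) (u.mulVec x k)) := by
        rw [Finset.sum_mul, Finset.mul_sum]
        refine Finset.sum_congr rfl fun i _ => ?_
        have h1 := hs (.inl i)
        have h2 := hs (.inr k)
        simp only [u, Matrix.of_apply, star_div₀, star_neg, RCLike.star_def, Complex.conj_ofReal]
        field_simp
      rw [hk]
      change -2 * (u.mulVec x k * (starRingEnd ℂ) (u.mulVec x k)) = _
      rw [Complex.mul_conj']
      push_cast
      rfl
    simp only [Sum.elim_inl, Sum.elim_inr] at h1
    rw [hsum, Complex.ofReal_re, Fintype.sum_sum_type] at h1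
    simp only [Sum.elim_inl, Sum.elim_inr, hn, norm_neg] at h1
    linarith
  have h2 := hφ u hu (fun k => ((√(w (.inr k)) : ℝ) : ℂ)) (fun i => ((√(w (.inl i)) : ℝ) : ℂ))
  have hsq : ∀ p, ‖((√(w p) : ℝ) : ℂ)‖ ^ 2 = w p := by
    intro p
    rw [Complex.norm_real, Real.norm_of_nonneg (Real.sqrt_nonneg _), Real.sq_sqrt (hw p).le]
  simp only [hsq] at h2
  have h3 : ∑ p : ι × κ, m p * φ p.1 p.2 = 2 * ∑ k, ∑ i, ((√(w (.inr k)) : ℝ) : ℂ) * u k i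
      * ((√(w (.inl i)) : ℝ) : ℂ) * φ i k := by
    rw [Fintype.sum_prod_type_right, Finset.mul_sum]
    refine Finset.sum_congr rfl fun k _ => ?_
    rw [Finset.mul_sum]
    refine Finset.sum_congr rfl fun i _ => ?_
    have h1 := hs (.inl i)
    have h2 := hs (.inr k)
    simp only [u, Matrix.of_apply]
    field_simp
  have h4 : -‖∑ p : ι × κ, m p * φ p.1 p.2‖ ≤ (∑ p : ι × κ, m p * φ p.1 p.2).re :=
    (abs_le.1 (Complex.abs_re_le_norm _)).1
  have h5 : ‖∑ p : ι × κ, m p * φ p.1 p.2‖ ≤ C * ∑ p, w p := by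
    rw [h3, norm_mul, Complex.norm_ofNat, Fintype.sum_sum_type]
    have ha : 0 ≤ ∑ i, w (.inl i) := Finset.sum_nonneg fun i _ => (hw _).le
    have hb : 0 ≤ ∑ k, w (.inr k) := Finset.sum_nonneg fun i _ => (hw _).le
    calc _ ≤ 2 * (C * (√(∑ k, w (.inr k)) * √(∑ i, w (.inl i)))) := by gcongr
      _ = C * (2 * √(∑ i, w (.inl i)) * √(∑ k, w (.inr k))) := by ring
      _ ≤ C * (√(∑ i, w (.inl i)) ^ 2 + √(∑ k, w (.inr k)) ^ 2) := by
        gcongr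
        exact two_mul_le_add_sq _ _
      _ = _ := by rw [Real.sq_sqrt ha, Real.sq_sqrt hb]
  linarith

/-- A separating functional is a pair `(m, w)`. Its positivity on rank-one matrices is the quadratic
form condition of the previous lemma, which contradicts separation. -/
lemma SchurBound.mem_closure_blockCone (hφ : SchurBound φ C) (hC : 0 ≤ C) :
    ((fun p => φ p.1 p.2, fun _ => C) : (ι × κ → ℂ) × (ι ⊕ κ → ℝ))
      ∈ closure (blockCone ι κ) := by
  classical
  by_contra hmem
  obtain ⟨f, r, hfr, hr⟩ := geometric_hahn_banach_point_closed convex_blockCone.closure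
    isClosed_closure hmem
  have hf0 : ∀ x ∈ blockCone ι κ, 0 ≤ f x := by
    intro x hx
    by_contra! hlt
    -- The scaling makes the value of `f` equal to −(|r| + 1), which is below `r`.
    have h1 := hr _ (subset_closure (smul_mem_blockCone hx (r := (|r| + 1) / (-f x))
      (div_nonneg (by positivity) (by linarith))))
    rw [map_smul, smul_eq_mul, div_mul_eq_mul_div, lt_div_iff₀ (by linarith)] at h1
    nlinarith [neg_abs_le r]
  have h0 : (0 : (ι × κ → ℂ) × (ι ⊕ κ → ℝ)) ∈ blockCone ι κ :=
    ⟨0, Matrix.PosSemidef.zero, by simp, by simp⟩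
  have hneg : f (fun p => φ p.1 p.2, fun _ => C) < 0 :=
    hfr.trans (by simpa using hr 0 (subset_closure h0))
  obtain ⟨m, hm⟩ := exists_eq_re_sum ((f : _ →ₗ[ℝ] ℝ).comp
    (LinearMap.inl ℝ (ι × κ → ℂ) (ι ⊕ κ → ℝ)))
  set w : ι ⊕ κ → ℝ := fun p => f (0, Pi.single p 1) with hw
  have hfw : ∀ d : ι ⊕ κ → ℝ, f (0, d) = ∑ p, w p * d p := by
    intro d
    have hd : ((0, d) : (ι × κ → ℂ) × (ι ⊕ κ → ℝ)) = ∑ p, d p • (0, Pi.single p 1) := by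
      ext q
      · simp [Prod.fst_sum]
      · rw [Prod.snd_sum, Finset.sum_apply]
        simp [Pi.single_apply, -Fintype.sum_sum_type]
    rw [hd, map_sum]
    exact Finset.sum_congr rfl fun p _ => by rw [map_smul, smul_eq_mul, mul_comm]
  have hf : ∀ M d, f (M, d) = (∑ p, m p * M p).re + ∑ p, w p * d p := by
    intro M d
    rw [← hfw, ← hm M, show ((M, d) : (ι × κ → ℂ) × (ι ⊕ κ → ℝ)) = (M, 0) + (0, d) by simp,
      map_add]
    rfl
  have hw0 : ∀ p, 0 ≤ w p := fun p => hf0 _ ⟨0, Matrix.PosSemidef.zero, by simp, fun q => by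
    by_cases h : q = p <;> simp [h]⟩
  have hquad : ∀ z : ι ⊕ κ → ℂ, 0 ≤ (∑ p : ι × κ,
      m p * (z (.inl p.1) * star (z (.inr p.2)))).re + ∑ p, w p * ‖z p‖ ^ 2 := by
    intro z
    rw [← hf]
    refine hf0 _ ⟨Matrix.vecMulVec z (star z), Matrix.posSemidef_vecMulVec_self_star z,
      fun p => by simp [Matrix.vecMulVec_apply], fun p => ?_⟩
    rw [Matrix.vecMulVec_apply, Pi.star_apply, RCLike.star_def, Complex.mul_conj']
    exact_mod_cast le_rfl
  -- The weights may vanish, so they are raised by `δ`, small enough that the total cost `C * N * δ`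
  -- is at most `η`.
  refine absurd hneg (not_lt.2 (le_of_forall_pos_le_add fun η hη => ?_))
  set N : ℝ := (Fintype.card (ι ⊕ κ) : ℝ) with hN
  have hN0 : 0 ≤ N := Nat.cast_nonneg _
  set δ : ℝ := η / (C * N + 1) with hδ
  have hδ0 : 0 < δ := by positivity
  have := hφ.nonneg_of_quadratic_form_nonneg hC m (fun p => w p + δ)
    (fun p => add_pos_of_nonneg_of_pos (hw0 p) hδ0) fun z => (hquad z).trans (by
      gcongr
      linarith)
  rw [Finset.sum_add_distrib, Finset.sum_const, Finset.card_univ, nsmul_eq_mul, ← hN,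
    mul_add] at this
  rw [hf, ← Finset.sum_mul, mul_comm _ C]
  have hle : C * (N * δ) ≤ η := by
    rw [hδ, ← mul_assoc, mul_div_assoc', div_le_iff₀ (by positivity)]
    nlinarith
  linarith

lemma SchurBound.exists_posSemidef (hφ : SchurBound φ C) (hC : 0 ≤ C) {ε : ℝ} (hε : 0 < ε) :
    ∃ G : Matrix (ι ⊕ κ) (ι ⊕ κ) ℂ, G.PosSemidef ∧
      (∀ i k, ‖G (.inl i) (.inr k) - φ i k‖ ≤ ε) ∧ ∀ p, (G p p).re ≤ C + ε := by
  obtain ⟨x, ⟨G, hG, hG1, hG2⟩, hx⟩ := Metric.mem_closure_iff.1 (hφ.mem_closure_blockCone hC) ε hε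
  rw [Prod.dist_eq, max_lt_iff] at hx
  refine ⟨G, hG, fun i k => ?_, fun p => (hG2 p).trans ?_⟩
  · rw [hG1 (i, k), ← dist_eq_norm, dist_comm]
    exact (dist_le_pi_dist (fun p : ι × κ => φ p.1 p.2) x.1 (i, k)).trans hx.1.le
  · have h := (dist_le_pi_dist (fun _ : ι ⊕ κ => C) x.2 p).trans hx.2.le
    rw [Real.dist_eq] at h
    linarith [(abs_le.1 h).1]

end Kernel

/-! ### Passage to infinite sets and Gram vectors. -/

section Gram

open scoped ComplexOrder MatrixOrder
open Filter Topology

universe u' v'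

/-- A positive semidefinite kernel is the Gram kernel of a family of vectors. -/
lemma Matrix.PosSemidef.exists_inner_eq {T : Type u'} {G : Matrix T T ℂ} (hG : G.PosSemidef) :
    ∃ (H : Type u') (_ : NormedAddCommGroup H) (_ : InnerProductSpace ℂ H) (_ : CompleteSpace H)
      (a : T → H), ∀ p q, inner ℂ (a p) (a q) = G p q := by
  -- Scalars become operators on `ℂ`, to form an operator-valued reproducing kernel.
  let K : Matrix T T (ℂ →L[ℂ] ℂ) := Matrix.of fun p q => G p q • 1
  have hK : K.PosSemidef := by
    have htfae := (RKHS.posSemidef_tfae (K := K)).out 0 2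
    refine htfae.2 ⟨?_, fun f => ?_⟩
    · ext p q
      simp [K, ← hG.isHermitian.apply p q]
    · have h := (Complex.nonneg_iff.1 (hG.2 f)).1
      refine h.trans_eq (congrArg Complex.re ?_)
      refine Finsupp.sum_congr fun p _ => Finsupp.sum_congr fun q _ => ?_
      simp [K, ← hG.isHermitian.apply p q]
      ring
  have : Fact K.PosSemidef := ⟨hK⟩
  refine ⟨RKHS.OfKernel K, inferInstance, inferInstance, inferInstance,
    fun p => RKHS.kerFun (RKHS.OfKernel K) p 1, fun p q => ?_⟩
  rw [← RKHS.kernel_inner, RKHS.OfKernel.kernel_ofKernel]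
  simp [K, ← hG.isHermitian.apply p q]

/-- Cauchy–Schwarz for the Gram vectors; it confines the entries to a compact disc. -/
lemma Matrix.PosSemidef.norm_apply_le {T : Type*} {G : Matrix T T ℂ} (hG : G.PosSemidef) {R : ℝ}
    (hR : ∀ p, (G p p).re ≤ R) (p q : T) : ‖G p q‖ ≤ R := by
  obtain ⟨H, _, _, _, a, ha⟩ := hG.exists_inner_eq
  have hn : ∀ p, ‖a p‖ ^ 2 ≤ R := by
    intro p
    rw [← inner_self_eq_norm_sq (𝕜 := ℂ), ha]
    exact hR p
  rw [← ha]
  refine (norm_inner_le_norm _ _).trans ?_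
  nlinarith [hn p, hn q, sq_nonneg (‖a p‖ - ‖a q‖)]

/-- Compactness: a function on `S × T` which can be approximated on finite sets by off-diagonal
blocks of positive semidefinite matrices is itself such a block. -/
lemma exists_posSemidef_of_approx {S : Type u'} {T : Type v'} (φ : S → T → ℂ) {C : ℝ} (hC : 0 ≤ C)
    (h : ∀ (F : Finset S) (F' : Finset T) (ε : ℝ), 0 < ε → F.Nonempty → F'.Nonempty →
      ∃ G : Matrix (F ⊕ F') (F ⊕ F') ℂ, G.PosSemidef ∧
        (∀ i k, ‖G (.inl i) (.inr k) - φ i k‖ ≤ ε) ∧ ∀ p, (G p p).re ≤ C + ε) :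
    ∃ G : Matrix (S ⊕ T) (S ⊕ T) ℂ, G.PosSemidef ∧
      (∀ s t, G (.inl s) (.inr t) = φ s t) ∧ ∀ p, (G p p).re ≤ C := by
  classical
  rcases isEmpty_or_nonempty S with hS | ⟨⟨s₀⟩⟩
  · exact ⟨0, Matrix.PosSemidef.zero, fun s => hS.elim s, by simp [hC]⟩
  rcases isEmpty_or_nonempty T with hT | ⟨⟨t₀⟩⟩
  · exact ⟨0, Matrix.PosSemidef.zero, fun _ t => hT.elim t, by simp [hC]⟩
  have hext : ∀ j : Finset S × Finset T × ℕ, ∃ G : Matrix (S ⊕ T) (S ⊕ T) ℂ, G.PosSemidef ∧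
      (∀ s ∈ j.1, ∀ t ∈ j.2.1, ‖G (.inl s) (.inr t) - φ s t‖ ≤ 1 / (j.2.2 + 1 : ℝ)) ∧
      ∀ p, (G p p).re ≤ C + 1 / (j.2.2 + 1 : ℝ) := by
    rintro ⟨F, F', n⟩
    obtain ⟨G, hG, hG1, hG2⟩ := h (insert s₀ F) (insert t₀ F') (1 / (n + 1 : ℝ)) (by positivity)
      (Finset.insert_nonempty _ _) (Finset.insert_nonempty _ _)
    -- Points outside the finite set go to the base point; pulling `G` back along such maps keeps it
    -- positive semidefinite.
    let r : S → ↥(insert s₀ F) := fun s =>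
      if hs : s ∈ insert s₀ F then ⟨s, hs⟩ else ⟨s₀, Finset.mem_insert_self _ _⟩
    let r' : T → ↥(insert t₀ F') := fun t =>
      if ht : t ∈ insert t₀ F' then ⟨t, ht⟩ else ⟨t₀, Finset.mem_insert_self _ _⟩
    refine ⟨G.submatrix (Sum.map r r') (Sum.map r r'), hG.submatrix _, fun s hs t ht => ?_,
      fun p => hG2 _⟩
    have h1 : r s = ⟨s, Finset.mem_insert_of_mem hs⟩ := dif_pos _
    have h2 : r' t = ⟨t, Finset.mem_insert_of_mem ht⟩ := dif_pos _
    simpa [h1, h2] using hG1 (r s) (r' t)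
  choose G hG hG1 hG2 using hext
  let U : Ultrafilter (Finset S × Finset T × ℕ) := Ultrafilter.of atTop
  have hU : (U : Filter (Finset S × Finset T × ℕ)) ≤ atTop := Ultrafilter.of_le atTop
  have hεlim : Tendsto (fun j : Finset S × Finset T × ℕ => 1 / (j.2.2 + 1 : ℝ)) U (𝓝 0) := by
    refine (tendsto_one_div_add_atTop_nhds_zero_nat (𝕜 := ℝ)).comp (Tendsto.mono_left ?_ hU)
    rw [← prod_atTop_atTop_eq, ← prod_atTop_atTop_eq]
    exact tendsto_snd.comp tendsto_snd
  have hlim : ∀ p q, ∃ g : ℂ, Tendsto (fun j => G j p q) U (𝓝 g) := by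
    intro p q
    have hb : ∀ j, G j p q ∈ Metric.closedBall (0 : ℂ) (C + 1) := by
      intro j
      rw [mem_closedBall_zero_iff]
      refine (hG j).norm_apply_le (fun p => (hG2 j p).trans ?_) p q
      gcongr
      rw [div_le_one (by positivity)]
      linarith [(Nat.cast_nonneg j.2.2 : (0 : ℝ) ≤ _)]
    obtain ⟨g, -, hg⟩ := (isCompact_closedBall (0 : ℂ) (C + 1)).ultrafilter_le_nhds
      (U.map fun j => G j p q) (by
        rw [Ultrafilter.coe_map, le_principal_iff, mem_map]
        exact Filter.univ_mem' hb)
    exact ⟨g, hg⟩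
  choose g hg using hlim
  refine ⟨Matrix.of g, ⟨?_, fun f => ?_⟩, fun s t => ?_, fun p => ?_⟩
  · ext p q
    refine tendsto_nhds_unique ((hg q p).star) ((hg p q).congr fun j => ?_)
    exact ((hG j).isHermitian.apply p q).symm
  · refine ge_of_tendsto' (x := (U : Filter _)) (f := fun j => f.sum fun p z => f.sum fun q z' =>
      star z * G j p q * z') ?_ fun j => (hG j).2 f
    refine tendsto_finsetSum _ fun p _ => tendsto_finsetSum _ fun q _ => ?_
    exact ((hg p q).const_mul _).mul_const _
  · refine tendsto_nhds_unique (hg _ _) ?_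
    rw [tendsto_iff_norm_sub_tendsto_zero]
    refine squeeze_zero' (.of_forall fun _ => norm_nonneg _) ?_ hεlim
    -- Beyond this index the finite sets contain `s` and `t`.
    filter_upwards [hU (eventually_ge_atTop ({s}, {t}, 0))] with j hj
    exact hG1 j s (hj.1 (Finset.mem_singleton_self s)) t (hj.2.1 (Finset.mem_singleton_self t))
  · refine le_of_tendsto_of_tendsto' ((Complex.continuous_re.tendsto _).comp (hg p p))
      (by simpa using hεlim.const_add C) fun j => hG2 j p

/-- Grothendieck–Haagerup factorization: a function on `S × T` that is a Schur multiplier of norm at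
most `C` factors through a Hilbert space. -/
lemma exists_inner_factorization {S T : Type u'} [DecidableEq S] (φ : S → T → ℂ) {C : ℝ}
    (hC : 0 ≤ C)
    (h : ∀ (F : Finset S) (F' : Finset T), SchurBound (fun (i : F) (k : F') => φ i k) C) :
    ∃ (H : Type u') (_ : NormedAddCommGroup H) (_ : InnerProductSpace ℂ H) (_ : CompleteSpace H)
      (a : S → H) (b : T → H), (∀ s t, inner ℂ (a s) (b t) = φ s t) ∧
        (∀ s, ‖a s‖ ≤ √C) ∧ ∀ t, ‖b t‖ ≤ √C := by
  obtain ⟨G, hG, hG1, hG2⟩ := exists_posSemidef_of_approx φ hC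
    fun F F' ε hε _ _ => (h F F').exists_posSemidef hC hε
  obtain ⟨H, i₁, i₂, i₃, v, hv⟩ := hG.exists_inner_eq
  have hn : ∀ p, ‖v p‖ ≤ √C := by
    intro p
    refine Real.le_sqrt_of_sq_le ?_
    rw [← inner_self_eq_norm_sq (𝕜 := ℂ), hv]
    exact hG2 p
  exact ⟨H, i₁, i₂, i₃, fun s => v (.inl s), fun t => v (.inr t), fun s t => by rw [hv, hG1],
    fun s => hn _, fun t => hn _⟩

end Gram

/-! ### Strongly measurable factors in a separable space. -/

section Measurability

open Filter Topology

variable {H : Type u} [NormedAddCommGroup H] [InnerProductSpace ℂ H]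

/-- An orthonormal family in a separable space is countable. -/
lemma Orthonormal.countable_of_separable [TopologicalSpace.SeparableSpace H] {ι : Type*} {v : ι → H}
    (hv : Orthonormal ℂ v) : Countable ι := by
  have hd : Set.PairwiseDisjoint (Set.univ : Set ι) fun i => Metric.ball (v i) (1 / 2) := by
    intro i _ j _ hij
    refine Metric.ball_disjoint_ball ?_
    have h : ‖v i - v j‖ ^ 2 = 2 := by
      rw [@norm_sub_sq ℂ, hv.2 hij, hv.1 i, hv.1 j]
      norm_num
    rw [dist_eq_norm]
    nlinarith [norm_nonneg (v i - v j)]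
  exact Set.countable_univ_iff.1 (hd.countable_of_isOpen (fun _ _ => Metric.isOpen_ball)
    fun i _ => ⟨v i, Metric.mem_ball_self (by norm_num)⟩)

/-- A separable Hilbert space embeds isometrically into `ℓ²`. -/
lemma exists_linearIsometry_lp (H : Type u) [NormedAddCommGroup H] [InnerProductSpace ℂ H]
    [CompleteSpace H] [TopologicalSpace.SeparableSpace H] :
    Nonempty (H →ₗᵢ[ℂ] lp (fun _ : ULift.{w} ℕ => ℂ) 2) := by
  obtain ⟨s, b, -⟩ := exists_hilbertBasis ℂ H
  have : Countable s := b.orthonormal.countable_of_separable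
  obtain ⟨j, hj⟩ := exists_injective_nat s
  -- `ULift` places ℓ² in the universe `w` of the factorizations.
  let e : HilbertBasis (ULift.{w} ℕ) ℂ (lp (fun _ : ULift.{w} ℕ => ℂ) 2) :=
    HilbertBasis.ofRepr (LinearIsometryEquiv.refl ℂ _)
  have ho : Orthonormal ℂ fun i : s => e (ULift.up (j i)) :=
    e.orthonormal.comp _ fun i i' h => hj (ULift.up_injective h)
  exact ⟨ho.orthogonalFamily.linearIsometry.comp b.repr.toLinearIsometry⟩

/-- The uniform bound `R` lets weak convergence pass from `D` to its closed span. -/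
lemma tendsto_inner_of_mem_closure_span {l : Filter ℕ} {a : ℕ → H} {a₀ : H} {R : ℝ}
    (ha : ∀ n, ‖a n‖ ≤ R) (ha₀ : ‖a₀‖ ≤ R) {D : Set H}
    (hD : ∀ d ∈ D, Tendsto (fun n => inner ℂ d (a n)) l (𝓝 (inner ℂ d a₀))) {y : H}
    (hy : y ∈ (Submodule.span ℂ D).topologicalClosure) :
    Tendsto (fun n => inner ℂ y (a n)) l (𝓝 (inner ℂ y a₀)) := by
  have hspan : ∀ d ∈ Submodule.span ℂ D,
      Tendsto (fun n => inner ℂ d (a n)) l (𝓝 (inner ℂ d a₀)) := by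
    intro d hd
    induction hd using Submodule.span_induction with
    | mem d hd => exact hD d hd
    | zero => simp only [inner_zero_left]; exact tendsto_const_nhds
    | add d d' _ _ h h' => simpa only [inner_add_left] using h.add h'
    | smul c d _ h => simpa only [inner_smul_left] using h.const_mul _
  have hR : 0 ≤ R := (norm_nonneg _).trans ha₀
  rw [Metric.tendsto_nhds]
  intro ε hε
  obtain ⟨d, hd, hyd⟩ := Metric.mem_closure_iff.1 hy (ε / (3 * (R + 1))) (by positivity)
  rw [dist_eq_norm, lt_div_iff₀ (by positivity)] at hyd
  have hb : ∀ z : H, ‖z‖ ≤ R → ‖(inner ℂ y z : ℂ) - inner ℂ d z‖ ≤ ε / 3 := by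
    intro z hz
    rw [← inner_sub_left]
    refine (norm_inner_le_norm _ _).trans ?_
    nlinarith [norm_nonneg (y - d), norm_nonneg z,
      mul_le_mul_of_nonneg_left hz (norm_nonneg (y - d))]
  filter_upwards [Metric.tendsto_nhds.1 (hspan d hd) (ε / 3) (by positivity)] with n hn
  rw [dist_eq_norm] at hn ⊢
  have h1 := hb (a n) (ha n)
  have h2 := hb a₀ ha₀
  calc ‖(inner ℂ y (a n) : ℂ) - inner ℂ y a₀‖
      = ‖((inner ℂ y (a n) : ℂ) - inner ℂ d (a n)) + (inner ℂ d (a n) - inner ℂ d a₀)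
        - (inner ℂ y a₀ - inner ℂ d a₀)‖ := by congr 1; ring
    _ ≤ ‖(inner ℂ y (a n) : ℂ) - inner ℂ d (a n)‖ + ‖(inner ℂ d (a n) : ℂ) - inner ℂ d a₀‖
        + ‖(inner ℂ y a₀ : ℂ) - inner ℂ d a₀‖ :=
      (norm_sub_le _ _).trans (by gcongr; exact norm_add_le _ _)
    _ < ε := by linarith

variable {Ω : Type u} [MeasurableSpace Ω] {μ : Measure Ω}

lemma aemeasurable_inner_of_mem_closure_span {a : Ω → H} {D : Set H}
    (hD : ∀ d ∈ D, AEMeasurable (fun s => (inner ℂ d (a s) : ℂ)) μ) {y : H}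
    (hy : y ∈ (Submodule.span ℂ D).topologicalClosure) :
    AEMeasurable (fun s => (inner ℂ y (a s) : ℂ)) μ := by
  have hspan : ∀ d ∈ Submodule.span ℂ D, AEMeasurable (fun s => (inner ℂ d (a s) : ℂ)) μ := by
    intro d hd
    induction hd using Submodule.span_induction with
    | mem d hd => exact hD d hd
    | zero => simp
    | add d d' _ _ h h' => simp only [inner_add_left]; exact h.add h'
    | smul c d _ h => simpa only [inner_smul_left] using h.const_mul _
  obtain ⟨d, hd, hlim⟩ := mem_closure_iff_seq_limit.1 hy
  exact aemeasurable_of_tendsto_metrizable_ae atTop (fun n => hspan _ (hd n))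
    (.of_forall fun s => hlim.inner tendsto_const_nhds)

/-- Pettis' theorem for separable Hilbert spaces. -/
lemma aestronglyMeasurable_of_inner [CompleteSpace H] [TopologicalSpace.SeparableSpace H]
    {a : Ω → H} (ha : ∀ y, AEMeasurable (fun s => (inner ℂ y (a s) : ℂ)) μ) :
    AEStronglyMeasurable a μ := by
  obtain ⟨s, b, -⟩ := exists_hilbertBasis ℂ H
  have : Countable s := b.orthonormal.countable_of_separable
  refine aestronglyMeasurable_of_tendsto_ae (atTop : Filter (Finset s))
    (f := fun F ω => ∑ i ∈ F, b.repr (a ω) i • b i) (fun F => ?_)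
    (.of_forall fun ω => b.hasSum_repr (a ω))
  refine Finset.aestronglyMeasurable_fun_sum F fun i _ => ?_
  simp only [b.repr_apply_apply]
  exact (ha (b i)).aestronglyMeasurable.smul_const _

/-- A Hilbert space factorization of `(s, t) ↦ g t (f s)`, with `f` strongly measurable and every
`g t` continuous, can be replaced by a strongly measurable one. -/
lemma exists_aestronglyMeasurable_factorization [CompleteSpace H] {Y : Type v}
    [PseudoMetricSpace Y] {f : Ω → Y} (hf : AEStronglyMeasurable f μ) {g : Ω → Y → ℂ}
    (hg : ∀ t, Continuous (g t)) (hgm : ∀ y, AEMeasurable (fun t => g t y) μ)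
    {a b : Ω → H} (hab : ∀ s t, inner ℂ (a s) (b t) = g t (f s)) {R : ℝ}
    (ha : ∀ s, ‖a s‖ ≤ R) (hb : ∀ t, ‖b t‖ ≤ R) :
    ∃ a' b' : Ω → lp (fun _ : ULift.{w} ℕ => ℂ) 2,
      AEStronglyMeasurable a' μ ∧ AEStronglyMeasurable b' μ ∧ (∀ s, ‖a' s‖ ≤ R) ∧
      (∀ t, ‖b' t‖ ≤ R) ∧ ∀ᵐ s ∂μ, ∀ t, inner ℂ (a' s) (b' t) = g t (f s) := by
  -- Projecting `a` onto the closed span of `b` keeps all inner products, and makes `a₀ s`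
  -- determined by `f s`, weakly continuously.
  set M : Submodule ℂ H := (Submodule.span ℂ (Set.range b)).topologicalClosure with hM
  have : CompleteSpace M := (Submodule.isClosed_topologicalClosure _).completeSpace_coe
  have hbM : ∀ t, b t ∈ M := fun t =>
    Submodule.le_topologicalClosure _ (Submodule.subset_span ⟨t, rfl⟩)
  set a₀ : Ω → H := fun s => M.starProjection (a s) with ha₀
  have ha₀R : ∀ s, ‖a₀ s‖ ≤ R := fun s => (M.norm_starProjection_apply_le _).trans (ha s)
  have ha₀b : ∀ s t, inner ℂ (a₀ s) (b t) = g t (f s) := by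
    intro s t
    rw [ha₀, M.inner_starProjection_left_eq_right, M.starProjection_eq_self_iff.2 (hbM t), hab]
  have hba₀ : ∀ s t, inner ℂ (b t) (a₀ s) = star (g t (f s)) := by
    intro s t
    rw [← ha₀b, RCLike.star_def, inner_conj_symm]
  have hinner : ∀ (y : H) s, (inner ℂ y (a₀ s) : ℂ) = inner ℂ (M.starProjection y) (a₀ s) := by
    intro y s
    rw [M.inner_starProjection_left_eq_right, ha₀]
    simp only
    rw [M.starProjection_eq_self_iff.2 (M.starProjection_apply_mem _)]
  -- a countable set of points whose images are dense in the essential range of `f`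
  obtain ⟨r, hr, hfr⟩ := hf.isSeparable_ae_range
  obtain ⟨c, hcr, hc, hrc⟩ :=
    (hr.mono (Set.inter_subset_left (t := Set.range f))).exists_countable_dense_subset
  have hpre : ∀ y : c, ∃ s, f s = y := fun y => (hcr y.2).2
  choose pre hpre using hpre
  have : Countable c := hc
  set K : Submodule ℂ H :=
    (Submodule.span ℂ (Set.range fun y : c => a₀ (pre y))).topologicalClosure with hK
  have : CompleteSpace K := (Submodule.isClosed_topologicalClosure _).completeSpace_coe
  have : TopologicalSpace.SeparableSpace K := by
    have h : TopologicalSpace.IsSeparable (K : Set H) :=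
      ((Set.countable_range fun y : c => a₀ (pre y)).isSeparable.span (R := ℂ)).closure
    exact h.separableSpace
  -- Almost every `f s` is a limit of chosen points, so `a₀ s` is a weak limit of vectors in `K`;
  -- `K`, being its own double orthogonal complement, is weakly closed.
  have haK : ∀ᵐ s ∂μ, a₀ s ∈ K := by
    filter_upwards [hfr] with s hs
    obtain ⟨y, hy, hlim⟩ := mem_closure_iff_seq_limit.1 (hrc ⟨hs, s, rfl⟩)
    have htend : ∀ z ∈ M, Tendsto (fun n => inner ℂ z (a₀ (pre ⟨y n, hy n⟩))) atTop
        (𝓝 (inner ℂ z (a₀ s))) := by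
      intro z hz
      refine tendsto_inner_of_mem_closure_span (fun n => ha₀R _) (ha₀R s) ?_ hz
      rintro _ ⟨t, rfl⟩
      simp only [hba₀, hpre]
      exact (((hg t).tendsto _).comp hlim).star
    rw [← K.orthogonal_orthogonal, Submodule.mem_orthogonal]
    intro z hz
    rw [hinner]
    refine tendsto_nhds_unique (htend _ (M.starProjection_apply_mem z)) ?_
    simp only [← hinner]
    refine tendsto_const_nhds.congr fun n => ?_
    exact (Submodule.inner_left_of_mem_orthogonal (Submodule.le_topologicalClosure _
      (Submodule.subset_span (Set.mem_range_self (⟨y n, hy n⟩ : c)))) hz).symm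
  have ham : ∀ y : K,
      AEMeasurable (fun s => (inner ℂ y (K.orthogonalProjectionOnto (a₀ s)) : ℂ)) μ := by
    intro y
    simp only [K.inner_orthogonalProjectionOnto_eq_of_mem_left, hinner (y : H)]
    refine aemeasurable_inner_of_mem_closure_span ?_ (M.starProjection_apply_mem (y : H))
    rintro _ ⟨t, rfl⟩
    simp only [hba₀]
    exact ((continuous_star.comp (hg t)).comp_aestronglyMeasurable hf).aemeasurable
  -- Against the generators of `K`, `b t` gives values of `g t` at fixed points, measurable in `t`
  -- by `hgm`.
  have hbm : ∀ y : K,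
      AEMeasurable (fun t => (inner ℂ y (K.orthogonalProjectionOnto (b t)) : ℂ)) μ := by
    intro y
    simp only [K.inner_orthogonalProjectionOnto_eq_of_mem_left]
    refine aemeasurable_inner_of_mem_closure_span ?_ y.2
    rintro _ ⟨z, rfl⟩
    simp only [ha₀b]
    exact hgm _
  obtain ⟨e⟩ := exists_linearIsometry_lp.{u, w} K
  refine ⟨fun s => e (K.orthogonalProjectionOnto (a₀ s)),
    fun t => e (K.orthogonalProjectionOnto (b t)),
    e.continuous.comp_aestronglyMeasurable (aestronglyMeasurable_of_inner ham),
    e.continuous.comp_aestronglyMeasurable (aestronglyMeasurable_of_inner hbm),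
    fun s => ?_, fun t => ?_, ?_⟩
  · rw [e.norm_map]
    exact (K.norm_orthogonalProjectionOnto_apply_le _).trans (ha₀R s)
  · rw [e.norm_map]
    exact (K.norm_orthogonalProjectionOnto_apply_le _).trans (hb t)
  -- Once `a₀ s` lies in `K`, projecting `b t` changes nothing, for all `t` at once.
  · filter_upwards [haK] with s hs t
    rw [e.inner_map_map, K.inner_orthogonalProjectionOnto_eq_of_mem_left]
    change inner ℂ (K.starProjection (a₀ s)) (b t) = _
    rw [K.starProjection_eq_self_iff.2 hs, ha₀b]

end Measurability

/-! ### Conclusion in 𝒱₂. -/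

lemma norm_toLp_top_le {Ω E : Type*} [MeasurableSpace Ω] {μ : Measure Ω} [NormedAddCommGroup E]
    {f : Ω → E} (hf : MemLp f ∞ μ) {r : ℝ} (hr : 0 ≤ r) (hb : ∀ s, ‖f s‖ ≤ r) :
    ‖hf.toLp f‖ ≤ r := by
  rw [Lp.norm_toLp, eLpNorm_exponent_top]
  exact ENNReal.toReal_le_of_le_ofReal hr (eLpNormEssSup_le_of_ae_bound (.of_forall hb))

/-- Almost everywhere bounded, strongly measurable factors give an element of `𝒱₂`. -/
lemma memV2_of_factorization {Ω₁ : Type u} {Ω₂ : Type v} [MeasurableSpace Ω₁] [MeasurableSpace Ω₂]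
    {μ₁ : Measure Ω₁} {μ₂ : Measure Ω₂} [SFinite μ₁] [SFinite μ₂] {K : Type w}
    [NormedAddCommGroup K] [InnerProductSpace ℂ K] [CompleteSpace K] {a : Ω₁ → K} {b : Ω₂ → K}
    (ha : AEStronglyMeasurable a μ₁) (hb : AEStronglyMeasurable b μ₂) {R R' : ℝ} (hR : 0 ≤ R)
    (hR' : 0 ≤ R') (haR : ∀ s, ‖a s‖ ≤ R) (hbR : ∀ t, ‖b t‖ ≤ R') {φ : Ω₁ × Ω₂ → ℂ}
    (hφ : ∀ᵐ s ∂μ₁, ∀ t, inner ℂ (a s) (b t) = φ (s, t)) :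
    MemV2.{u, v, w} μ₁ μ₂ φ ∧ nu2.{u, v, w} μ₁ μ₂ φ ≤ R * R' := by
  have ha' : MemLp a ∞ μ₁ := memLp_top_of_bound ha R (.of_forall haR)
  have hb' : MemLp b ∞ μ₂ := memLp_top_of_bound hb R' (.of_forall hbR)
  have hprod : ∀ᵐ p ∂(μ₁.prod μ₂), inner ℂ (a p.1) (b p.2) = φ p := by
    filter_upwards [Measure.quasiMeasurePreserving_fst.ae hφ] with p hp using hp p.2
  have hmem : ‖ha'.toLp a‖ * ‖hb'.toLp b‖ ∈ v2FactorizationNorms.{u, v, w} μ₁ μ₂ φ := by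
    refine ⟨K, inferInstance, inferInstance, inferInstance, ha'.toLp a, hb'.toLp b, ?_, rfl⟩
    filter_upwards [hprod, Measure.quasiMeasurePreserving_fst.ae ha'.coeFn_toLp,
      Measure.quasiMeasurePreserving_snd.ae hb'.coeFn_toLp] with p hp h1 h2
    rw [h1, h2, hp]
  refine ⟨⟨?_, _, hmem⟩, (csInf_le ⟨0, ?_⟩ hmem).trans ?_⟩
  · refine MemLp.ae_eq hprod (memLp_top_of_bound ?_ (R * R') (.of_forall fun p => ?_))
    · exact (ha.comp_quasiMeasurePreserving Measure.quasiMeasurePreserving_fst).inner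
        (hb.comp_quasiMeasurePreserving Measure.quasiMeasurePreserving_snd)
    · exact (norm_inner_le_norm _ _).trans (mul_le_mul (haR _) (hbR _) (norm_nonneg _) hR)
  · rintro _ ⟨K', _, _, _, a', b', -, rfl⟩
    positivity
  · gcongr
    · exact norm_toLp_top_le ha' hR haR
    · exact norm_toLp_top_le hb' hR' hbR

theorem mainTheorem1 {Ω : Type u} [MeasurableSpace Ω] (μ : Measure Ω) [SigmaFinite μ]
    {X : Type v} [NormedAddCommGroup X] [NormedSpace ℂ X] [CompleteSpace X]
    (A B : Ω → X →L[ℂ] X)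
    (hAm : ∀ x : X, AEStronglyMeasurable (fun t => A t x) μ)
    (hBm : ∀ x : X, AEStronglyMeasurable (fun t => B t x) μ)
    (hA : IsGammaBounded A) (hB : IsGammaBounded B)
    (x : X) (xs : StrongDual ℂ X) :
    MemV2.{u, u, w} μ μ (fun p : Ω × Ω => xs (B p.2 (A p.1 x))) ∧
      nu2.{u, u, w} μ μ (fun p : Ω × Ω => xs (B p.2 (A p.1 x))) ≤
        gammaConst A * gammaConst B * ‖x‖ * ‖xs‖ := by
  classical
  have hA' : IsGammaBound (Set.range A) (gammaConst A) := IsGammaBoundedSet.isGammaBound hA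
  have hB' : IsGammaBound (Set.range B) (gammaConst B) := IsGammaBoundedSet.isGammaBound hB
  set C : ℝ := gammaConst A * gammaConst B * ‖x‖ * ‖xs‖ with hCdef
  have hC : 0 ≤ C := by
    have := hA'.1
    have := hB'.1
    positivity
  obtain ⟨H, _, _, _, a, b, hab, ha, hb⟩ := exists_inner_factorization
    (fun s t => xs (B t (A s x))) hC fun F F' u hu c d =>
      norm_sum_bilinear_le hA' hB' (fun i : F => A i) (fun k : F' => B k) (fun i => ⟨i, rfl⟩)
        (fun k => ⟨k, rfl⟩) hu c d x xs
  -- Here `f s = A s x` takes values in `X`, and `g t` is the functional `xs ∘ B t`.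
  obtain ⟨a', b', ha'm, hb'm, ha', hb', hab'⟩ :=
    exists_aestronglyMeasurable_factorization.{u, v, w} (hAm x) (g := fun t y => xs (B t y))
      (fun t => by fun_prop)
      (fun y => (xs.continuous.comp_aestronglyMeasurable (hBm y)).aemeasurable) hab ha hb
  have := memV2_of_factorization ha'm hb'm (Real.sqrt_nonneg C) (Real.sqrt_nonneg C) ha' hb'
    (φ := fun p : Ω × Ω => xs (B p.2 (A p.1 x))) hab'
  rwa [Real.mul_self_sqrt hC] at this
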